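/- Let $d \ge 1$. The braid arrangement in $\mathbb{R}^d$ consists of the hyperplanes $\{x : x_i = x_j\}$, $1 \le i < j \le d$; the closures of the connected components of the complement of their union, together with all faces of these closed cones, form the fan $\mathcal{B}_{d-1}$. The normal fan of a non-empty polytope $P \subset \mathbb{R}^d$ is the set of the cones $N_F P = \{c \in \mathbb{R}^d : \langle c, x\rangle \ge \langle c, y\rangle \text{ for all } x \in F,\ y \in P\}$, where $F$ ranges over the non-empty faces of $P$. A polytope is inscribed if its vertices lie on a common sphere. The inscribed cone of $\mathcal{B}_{d-1}$ is the set of all inscribed polytopes in $\mathbb{R}^d$ with normal fan $\mathcal{B}_{d-1}$, modulo translations, and the closed inscribed cone is its closure in the Hausdorff metric. For $z \in \mathbb{R}^d$ let $P(z) = \operatorname{conv}\{(z_{\sigma(1)},\dots,z_{\sigma(d)}) : \sigma \in S_d\}$ be the permutahedron of $z$, and let the hypersimplex $\Delta(d,k)$ be the convex hull of the vectors in $\{0,1\}^d$ with exactly $k$ entries equal to $1$. Let $P$ be a polytope (representing a translation class) in the closed inscribed cone of $\mathcal{B}_{d-1}$. Then there is a point $c(P)$ in the affine hull of $P$ that is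 equidistant from all vertices of $P$, and there is $z \in \mathbb{R}^d$ with $z_1 \le z_2 \le \cdots \le z_d$ such that $$P - c(P) \;=\; P(z) \;=\; z_1\,\Delta(d,d) + \sum_{i=2}^{d} (z_i - z_{i-1})\,\Delta(d, d-i+1),$$ where sums are Minkowski sums. Thus, up to translation (note that $\Delta(d,d)$ is the single point $(1,\dots,1)$), $P$ is a nonnegative combination of the hypersimplices $\Delta(d,1),\dots,\Delta(d,d-1)$. Moreover $P - c(P)$ is invariant under the action of $S_d$ that permutes the coordinates. -/

import Mathlib

open scoped Pointwise
open TopologicalSpace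

noncomputable section

/-- The Euclidean space `ℝ^d`. -/
abbrev EucSpace (d : ℕ) : Type := EuclideanSpace ℝ (Fin d)

/-- `P` is a non-empty convex polytope: the convex hull of a non-empty finite set of points. -/
def IsPolytope {d : ℕ} (P : Set (EucSpace d)) : Prop :=
  ∃ s : Finset (EucSpace d), s.Nonempty ∧ P = convexHull ℝ (s : Set (EucSpace d))

/-- The set `P^c` of points of `P` that maximize the linear function `x ↦ ⟪c, x⟫` over `P`.
The non-empty faces of a polytope, and of a polyhedral cone, are exactly its non-empty subsets
of this form. -/
def maxFace {d : ℕ} (P : Set (EucSpace d)) (c : EucSpace d) : Set (EucSpace d) :=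
  {x | x ∈ P ∧ ∀ y ∈ P, inner ℝ c y ≤ inner ℝ c x}

/-- `F` is a non-empty face of the polytope or polyhedral cone `P`. -/
def IsFaceOf {d : ℕ} (F P : Set (EucSpace d)) : Prop :=
  F.Nonempty ∧ ∃ c : EucSpace d, F = maxFace P c

/-- The normal cone `N_F P = {c | F ⊆ P^c}`. -/
def normalConeAt {d : ℕ} (P F : Set (EucSpace d)) : Set (EucSpace d) :=
  {c | F ⊆ maxFace P c}

/-- The normal fan of `P`: the collection of the normal cones at the non-empty faces of `P`. -/
def normalFan {d : ℕ} (P : Set (EucSpace d)) : Set (Set (EucSpace d)) :=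
  {C | ∃ F : Set (EucSpace d), IsFaceOf F P ∧ C = normalConeAt P F}

/-- `P` is inscribed: its vertices lie on a common sphere. -/
def IsInscribed {d : ℕ} (P : Set (EucSpace d)) : Prop :=
  ∃ (c : EucSpace d) (r : ℝ), 0 < r ∧ Set.extremePoints ℝ P ⊆ Metric.sphere c r

/-- `c` is the center `c(P)` of an inscribed polytope `P`, that is, the center of the unique
inscribing sphere of `P` relative to its affine hull. The radius is `0` if `P` is a point. -/
def IsInscribedCenter {d : ℕ} (P : Set (EucSpace d)) (c : EucSpace d) : Prop :=
  c ∈ affineSpan ℝ P ∧ ∃ r : ℝ, Set.extremePoints ℝ P ⊆ Metric.sphere c r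

/-- The inscribed cone of a fan: the inscribed polytopes with that normal fan. This set is
invariant under translations and stands for the corresponding set of translation classes. -/
def inscribedCone {d : ℕ} (𝒩 : Set (Set (EucSpace d))) : Set (NonemptyCompacts (EucSpace d)) :=
  {P | IsPolytope (P : Set (EucSpace d)) ∧ IsInscribed (P : Set (EucSpace d)) ∧
    normalFan (P : Set (EucSpace d)) = 𝒩}

/-- The closed inscribed cone: the closure of the inscribed cone in the Hausdorff metric, which
is the metric of `NonemptyCompacts`. As `inscribedCone 𝒩` is invariant under translations, so is
its closure, which stands for the closure of the set of translation classes. -/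
def closedInscribedCone {d : ℕ} (𝒩 : Set (Set (EucSpace d))) :
    Set (NonemptyCompacts (EucSpace d)) :=
  closure (inscribedCone 𝒩)

/-- The complement in `ℝ^d` of the union of the hyperplanes `x_i = x_j`, `i < j`, of the
braid arrangement. -/
def braidComplement (d : ℕ) : Set (EucSpace d) :=
  (⋃ (i : Fin d) (j : Fin d) (_ : i < j), {x : EucSpace d | x i = x j})ᶜ

/-- The regions of the braid arrangement: the closures of the connected components of the
complement of its hyperplanes. -/
def braidRegions (d : ℕ) : Set (Set (EucSpace d)) :=
  {R | ∃ x ∈ braidComplement d, R = closure (connectedComponentIn (braidComplement d) x)}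

/-- The fan of the braid arrangement: the regions together with all their faces. -/
def braidFan (d : ℕ) : Set (Set (EucSpace d)) :=
  {C | ∃ R ∈ braidRegions d, IsFaceOf C R}

/-- The action of a permutation on `ℝ^d` by permuting coordinates. -/
def permuteCoords {d : ℕ} (σ : Equiv.Perm (Fin d)) (x : EucSpace d) : EucSpace d :=
  WithLp.toLp 2 (fun i => x (σ i))

/-- The permutahedron `P(z)`: the convex hull of all points that arise from `z` by permuting
its coordinates. -/
def permutahedron {d : ℕ} (z : EucSpace d) : Set (EucSpace d) :=
  convexHull ℝ (Set.range fun σ : Equiv.Perm (Fin d) => permuteCoords σ z)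

/-- The hypersimplex `Δ(d, k)`: the convex hull of the `0/1`-vectors in `ℝ^d` with exactly `k`
entries equal to `1`. -/
def hypersimplex (d k : ℕ) : Set (EucSpace d) :=
  convexHull ℝ {x : EucSpace d | (∀ i, x i = 0 ∨ x i = 1) ∧ {i : Fin d | x i = 1}.ncard = k}

end

/-!
Let `P` be inscribed in a sphere with center `c` and let its normal fan be the braid fan. Its
vertices `v τ` are indexed by the permutations `τ`, where `v τ` maximizes the linear functions in
the region `x (τ 0) ≤ x (τ 1) ≤ ⋯`. The difference of the vertices of two regions that share a wall
is orthogonal to this wall, and both vertices have the same distance from `c`; so the reflection in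
the wall interchanges `v τ - c` and the neighboring vertex. As these reflections are the adjacent
transpositions, `P = c + P(z)` for a vector `z`. Moving a multiple of `(1, …, 1)` from `z` to `c`
makes the entries of `z` sum to `0`, and then `c` lies in `P`.

The map `(c, z) ↦ c + P(z)` is continuous, and `c` and `z` are bounded in terms of `c + P(z)` if the
entries of `z` sum to `0`. Hence the sets `c + P(z)` of this kind form a closed set, which contains
the closed inscribed cone.

The formula for `P(z)` holds because `z ↦ P(z)` is additive on monotone vectors, by the
rearrangement inequality, and the `0/1`-vectors with non-decreasing entries have the hypersimplices
as their permutahedra.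
-/

section ConvexHull

variable {E : Type*}

theorem mem_of_forall_exists_inner_le [NormedAddCommGroup E] [InnerProductSpace ℝ E]
    [CompleteSpace E] {K : Set E} (hconv : Convex ℝ K) (hclosed : IsClosed K) {x : E}
    (h : ∀ c : E, ∃ y ∈ K, inner ℝ c x ≤ inner ℝ c y) : x ∈ K := by
  by_contra hx
  obtain ⟨f, u, hf, hu⟩ := geometric_hahn_banach_closed_point hconv hclosed hx
  obtain ⟨y, hy, hxy⟩ := h ((InnerProductSpace.toDual ℝ E).symm f)
  simp only [InnerProductSpace.toDual_symm_apply] at hxy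
  linarith [hf y hy]

variable {ι : Type*} [NormedAddCommGroup E] [NormedSpace ℝ E]

/-- The convex hull of a finite family of points, as an element of the space of non-empty compact
sets with the Hausdorff metric. -/
noncomputable def convexHullRange [Finite ι] [Nonempty ι] (v : ι → E) : NonemptyCompacts E where
  carrier := convexHull ℝ (Set.range v)
  isCompact' := Set.Finite.isCompact_convexHull (𝕜 := ℝ) (Set.finite_range v)
  nonempty' := (Set.range_nonempty v).convexHull

theorem convexHull_range_subset_cthickening [Fintype ι] (v w : ι → E) :
    convexHull ℝ (Set.range v) ⊆
      Metric.cthickening (dist v w) (convexHull ℝ (Set.range w)) := by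
  refine convexHull_min ?_ ((convex_convexHull ℝ _).cthickening _)
  rintro _ ⟨i, rfl⟩
  exact Metric.mem_cthickening_of_dist_le _ _ _ _ (subset_convexHull ℝ _ ⟨i, rfl⟩)
    (dist_le_pi_dist v w i)

theorem lipschitzWith_convexHullRange [Fintype ι] [Nonempty ι] :
    LipschitzWith 1 (convexHullRange : (ι → E) → NonemptyCompacts E) := fun v w => by
  rw [ENNReal.coe_one, one_mul]
  refine Metric.hausdorffEDist_le_of_infEDist (fun x hx => ?_) fun x hx => ?_
  · rw [edist_dist]
    exact Metric.mem_cthickening_iff.1 (convexHull_range_subset_cthickening v w hx)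
  · rw [edist_comm, edist_dist]
    exact Metric.mem_cthickening_iff.1 (convexHull_range_subset_cthickening w v hx)

end ConvexHull

section MaxFace

variable {d : ℕ} {P Q F S : Set (EucSpace d)} {c x y v : EucSpace d}

theorem inner_eq_of_mem_maxFace (hx : x ∈ maxFace P c) (hy : y ∈ maxFace P c) :
    inner ℝ c x = inner ℝ c y :=
  le_antisymm (hy.2 x hx.1) (hx.2 y hy.1)

theorem add_mem_maxFace_add (hx : x ∈ maxFace P c) (hy : y ∈ maxFace Q c) :
    x + y ∈ maxFace (P + Q) c := by
  refine ⟨Set.add_mem_add hx.1 hy.1, ?_⟩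
  rintro _ ⟨p, hp, q, hq, rfl⟩
  simp only [inner_add_right]
  exact add_le_add (hx.2 p hp) (hy.2 q hq)

theorem mem_maxFace_convexHull (hx : x ∈ maxFace S c) : x ∈ maxFace (convexHull ℝ S) c :=
  ⟨subset_convexHull ℝ S hx.1, fun _ hy =>
    convexHull_min hx.2 (convex_halfSpace_le (innerₛₗ ℝ c).isLinear _) hy⟩

theorem isExposed_maxFace (P : Set (EucSpace d)) (c : EucSpace d) :
    IsExposed ℝ P (maxFace P c) :=
  fun _ => ⟨innerSL ℝ c, rfl⟩

theorem mem_extremePoints_of_maxFace_eq_singleton (h : maxFace P c = {v}) :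
    v ∈ Set.extremePoints ℝ P :=
  exposedPoints_subset_extremePoints
    (mem_exposedPoints_iff_exposed_singleton.2 (h ▸ isExposed_maxFace P c))

theorem eq_convexHull_of_forall_exists_mem_maxFace (hP : Convex ℝ P) (hS : S.Finite)
    (hSP : S ⊆ P) (h : ∀ c, ∃ v ∈ S, v ∈ maxFace P c) : P = convexHull ℝ S := by
  refine Set.Subset.antisymm (fun x hx => ?_) (convexHull_min hSP hP)
  refine mem_of_forall_exists_inner_le (convex_convexHull ℝ S)
    (Set.Finite.isCompact_convexHull (𝕜 := ℝ) hS).isClosed fun c => ?_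
  obtain ⟨v, hvS, hv⟩ := h c
  exact ⟨v, subset_convexHull ℝ S hvS, hv.2 x hx⟩

end MaxFace

section PermuteCoords

variable {d : ℕ}

@[simp]
theorem permuteCoords_apply (σ : Equiv.Perm (Fin d)) (x : EucSpace d) (i : Fin d) :
    permuteCoords σ x i = x (σ i) := rfl

@[simp]
theorem permuteCoords_one (x : EucSpace d) : permuteCoords 1 x = x := rfl

theorem permuteCoords_permuteCoords (σ τ : Equiv.Perm (Fin d)) (x : EucSpace d) :
    permuteCoords σ (permuteCoords τ x) = permuteCoords (τ * σ) x := rfl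

/-- The action of a permutation on `ℝ^d`, as a linear isometry. -/
noncomputable def permuteCoordsIsometry (σ : Equiv.Perm (Fin d)) : EucSpace d ≃ₗᵢ[ℝ] EucSpace d :=
  LinearIsometryEquiv.piLpCongrLeft 2 ℝ ℝ σ.symm

theorem coe_permuteCoordsIsometry (σ : Equiv.Perm (Fin d)) :
    ⇑(permuteCoordsIsometry σ) = permuteCoords σ := rfl

theorem norm_permuteCoords (σ : Equiv.Perm (Fin d)) (x : EucSpace d) :
    ‖permuteCoords σ x‖ = ‖x‖ :=
  (permuteCoordsIsometry σ).norm_map x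

theorem permuteCoords_injective (σ : Equiv.Perm (Fin d)) :
    Function.Injective (permuteCoords σ) :=
  (permuteCoordsIsometry σ).injective

theorem inner_permuteCoords_inv (σ : Equiv.Perm (Fin d)) (x y : EucSpace d) :
    inner ℝ (permuteCoords σ⁻¹ x) y = inner ℝ x (permuteCoords σ y) :=
  ((permuteCoordsIsometry σ).inner_map_map (permuteCoords σ⁻¹ x) y).symm.trans <| by
    rw [coe_permuteCoordsIsometry, permuteCoords_permuteCoords, inv_mul_cancel, permuteCoords_one]

theorem permuteCoords_swap (i j : Fin d) (x : EucSpace d) :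
    permuteCoords (Equiv.swap i j) x =
      x - (x i - x j) • (EuclideanSpace.single i 1 - EuclideanSpace.single j 1) := by
  ext k
  rcases eq_or_ne k i with rfl | hi
  · rcases eq_or_ne k j with rfl | hj <;> simp [*]
  rcases eq_or_ne k j with rfl | hj
  · simp [hi]
  · simp [hi, hj, Equiv.swap_apply_of_ne_of_ne]

theorem reflection_single_sub_single (i j : Fin d) (x : EucSpace d) :
    (ℝ ∙ (EuclideanSpace.single i (1 : ℝ) - EuclideanSpace.single j 1))ᗮ.reflection x =
      permuteCoords (Equiv.swap i j) x := by
  rw [Submodule.reflection_orthogonal_apply, Submodule.reflection_singleton_apply,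
    permuteCoords_swap, RCLike.ofReal_real_eq_id, id]
  rcases eq_or_ne i j with rfl | hij
  · simp
  have hnorm : ‖(EuclideanSpace.single i 1 - EuclideanSpace.single j 1 : EucSpace d)‖ ^ 2 = 2 := by
    norm_num [norm_sub_sq_real, EuclideanSpace.inner_single_left, hij]
  simp only [hnorm, inner_sub_left, EuclideanSpace.inner_single_left, map_one, one_mul]
  module

/-- Two vectors of equal norm whose difference is orthogonal to a hyperplane are mirror images of
each other; here the hyperplane is `x i = x j`. -/
theorem permuteCoords_swap_of_sub_eq_smul {a b : EucSpace d} {i j : Fin d} {t : ℝ}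
    (hab : a - b = t • (EuclideanSpace.single i 1 - EuclideanSpace.single j 1))
    (hnorm : ‖a‖ = ‖b‖) (hne : a ≠ b) : permuteCoords (Equiv.swap i j) a = b := by
  have ht : t ≠ 0 := by
    rintro rfl
    exact hne (sub_eq_zero.1 (hab.trans (zero_smul ℝ _)))
  have hrefl := Submodule.reflection_sub hnorm
  simp only [hab, Submodule.span_singleton_smul_eq ht.isUnit] at hrefl
  rw [← reflection_single_sub_single, hrefl]

end PermuteCoords

section BraidCone

variable {d : ℕ}

/-- The closed region of the braid arrangement on which `x (τ 0) ≤ x (τ 1) ≤ ⋯`. -/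
def braidCone (τ : Equiv.Perm (Fin d)) : Set (EucSpace d) :=
  {x | Monotone (x.ofLp ∘ τ)}

/-- The open region of the braid arrangement on which `x (τ 0) < x (τ 1) < ⋯`. -/
def braidChamber (τ : Equiv.Perm (Fin d)) : Set (EucSpace d) :=
  {x | StrictMono (x.ofLp ∘ τ)}

theorem mem_braidCone_sort (x : EucSpace d) : x ∈ braidCone (Tuple.sort x.ofLp) :=
  Tuple.monotone_sort x.ofLp

theorem permuteCoords_inv_mem_braidCone (τ : Equiv.Perm (Fin d)) {x : EucSpace d}
    (hx : Monotone x.ofLp) : permuteCoords τ⁻¹ x ∈ braidCone τ := fun i j hij => by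
  simpa using hx hij

theorem mem_braidCone_mul_swap {τ : Equiv.Perm (Fin d)} {x : EucSpace d} {i j : Fin d}
    (hx : x ∈ braidCone τ) (hij : x (τ i) = x (τ j)) : x ∈ braidCone (τ * Equiv.swap i j) := by
  have h : x.ofLp ∘ (τ * Equiv.swap i j) = x.ofLp ∘ τ :=
    funext fun k => Equiv.apply_swap_eq_self (v := x.ofLp ∘ τ) hij k
  simpa only [braidCone, Set.mem_ofPred_eq, h] using hx

theorem mem_braidComplement {x : EucSpace d} :
    x ∈ braidComplement d ↔ Function.Injective x.ofLp := by
  simp only [braidComplement, Set.mem_compl_iff, Set.mem_iUnion, Set.mem_ofPred_eq, not_exists]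
  refine ⟨fun h i j hij => ?_, fun h i j hij => h.ne hij.ne⟩
  rcases lt_trichotomy i j with hlt | heq | hlt
  · exact absurd hij (h i j hlt)
  · exact heq
  · exact absurd hij.symm (h j i hlt)

theorem braidChamber_subset_braidCone (τ : Equiv.Perm (Fin d)) :
    braidChamber τ ⊆ braidCone τ :=
  fun _ hx => StrictMono.monotone hx

theorem braidChamber_subset_braidComplement (τ : Equiv.Perm (Fin d)) :
    braidChamber τ ⊆ braidComplement d := fun _ hx =>
  mem_braidComplement.2 ((τ.injective_comp _).1 (StrictMono.injective hx))

theorem nonempty_braidChamber (τ : Equiv.Perm (Fin d)) : (braidChamber τ).Nonempty :=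
  ⟨WithLp.toLp 2 fun i => ((τ⁻¹ i : Fin d) : ℝ), fun i j hij => by simpa using hij⟩

theorem braidCone_injective :
    Function.Injective (braidCone : Equiv.Perm (Fin d) → Set (EucSpace d)) := by
  intro σ τ h
  obtain ⟨x, hx⟩ := nonempty_braidChamber σ
  have hσ : x ∈ braidCone σ := braidChamber_subset_braidCone σ hx
  have hτ : x ∈ braidCone τ := h ▸ hσ
  have hinj := mem_braidComplement.1 (braidChamber_subset_braidComplement σ hx)
  exact Equiv.ext fun i => hinj (congrFun (Tuple.unique_monotone hσ hτ) i)

theorem convex_braidChamber (τ : Equiv.Perm (Fin d)) : Convex ℝ (braidChamber τ) := by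
  intro x hx y hy a b ha hb hab i j hij
  have hpos : 0 < a • (x (τ j) - x (τ i)) + b • (y (τ j) - y (τ i)) :=
    convex_Ioi 0 (sub_pos.2 (hx hij)) (sub_pos.2 (hy hij)) ha hb hab
  simp only [smul_eq_mul, Function.comp_apply, PiLp.add_apply, PiLp.smul_apply] at hpos ⊢
  linarith

theorem isClosed_braidCone (τ : Equiv.Perm (Fin d)) : IsClosed (braidCone τ) :=
  isClosed_monotone.preimage (by fun_prop)

theorem connectedComponentIn_braidComplement {τ : Equiv.Perm (Fin d)} {x : EucSpace d}
    (hx : x ∈ braidChamber τ) :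
    connectedComponentIn (braidComplement d) x = braidChamber τ := by
  have hxc := braidChamber_subset_braidComplement τ hx
  refine Set.Subset.antisymm (fun y hy i j hij => ?_)
    ((convex_braidChamber τ).isPreconnected.subset_connectedComponentIn hx
      (braidChamber_subset_braidComplement τ))
  by_contra! hle
  obtain ⟨w, hw, hwij⟩ := isPreconnected_connectedComponentIn.intermediate_value₂
    (f := fun w : EucSpace d => w (τ i)) (g := fun w : EucSpace d => w (τ j))
    (mem_connectedComponentIn hxc) hy (by fun_prop) (by fun_prop) (hx hij).le hle
  have hinj := mem_braidComplement.1 (connectedComponentIn_subset _ _ hw)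
  exact hij.ne (τ.injective (hinj hwij))

theorem closure_braidChamber (τ : Equiv.Perm (Fin d)) :
    closure (braidChamber τ) = braidCone τ := by
  refine Set.Subset.antisymm
    (closure_minimal (braidChamber_subset_braidCone τ) (isClosed_braidCone τ)) fun x hx => ?_
  obtain ⟨y, hy⟩ := nonempty_braidChamber τ
  have hcont : Continuous fun ε : ℝ => x + ε • y := by fun_prop
  have hlim : Filter.Tendsto (fun ε : ℝ => x + ε • y) (nhdsWithin 0 (Set.Ioi 0)) (nhds x) := by
    simpa using (hcont.tendsto 0).mono_left nhdsWithin_le_nhds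
  refine mem_closure_of_tendsto hlim ?_
  filter_upwards [self_mem_nhdsWithin] with ε hε i j hij
  exact add_lt_add_of_le_of_lt (hx hij.le) (mul_lt_mul_of_pos_left (hy hij) hε)

theorem braidCone_mem_braidFan (τ : Equiv.Perm (Fin d)) : braidCone τ ∈ braidFan d := by
  obtain ⟨x, hx⟩ := nonempty_braidChamber τ
  refine ⟨braidCone τ, ⟨x, braidChamber_subset_braidComplement τ hx, ?_⟩,
    ⟨x, braidChamber_subset_braidCone τ hx⟩, 0, ?_⟩
  · rw [connectedComponentIn_braidComplement hx, closure_braidChamber]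
  · simp [maxFace]

end BraidCone

section StepVector

variable {d : ℕ}

/-- The vector in `ℝ^d` with the entries `0` at the indices below `m` and `1` at the others. With
`-stepVector d 0`, these vectors generate the cone of monotone vectors. -/
noncomputable def stepVector (d m : ℕ) : EucSpace d :=
  WithLp.toLp 2 fun i => if m ≤ i then 1 else 0

theorem stepVector_apply (m : ℕ) (i : Fin d) :
    stepVector d m i = if m ≤ i then 1 else 0 := rfl

theorem monotone_stepVector (m : ℕ) : Monotone (stepVector d m).ofLp := fun i j hij => by
  have := Fin.le_def.1 hij
  simp only [stepVector_apply]
  split_ifs <;> first | omega | norm_num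

theorem stepVector_apply_eq_zero_or_one (m : ℕ) (i : Fin d) :
    stepVector d m i = 0 ∨ stepVector d m i = 1 := by
  rw [stepVector_apply]
  split_ifs <;> simp

theorem ncard_stepVector_eq_one (m : ℕ) : {i : Fin d | stepVector d m i = 1}.ncard = d - m := by
  have h : {i : Fin d | stepVector d m i = 1} = {i : Fin d | (i : ℕ) < m}ᶜ := by
    ext i
    simp [stepVector_apply]
  rw [h, Set.ncard_compl, Nat.card_fin, Set.ncard_eq_toFinset_card', Set.toFinset_ofPred,
    Fin.card_filter_val_lt]
  omega

theorem inner_stepVector_sub_inner_stepVector_succ (x : EucSpace d) (j : Fin d) :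
    inner ℝ (stepVector d j) x - inner ℝ (stepVector d (j + 1)) x = x j := by
  have h : stepVector d j - stepVector d (j + 1) = EuclideanSpace.single j 1 := by
    ext i
    simp only [PiLp.sub_apply, stepVector_apply, PiLp.single_apply, Fin.ext_iff]
    split_ifs <;> first | omega | norm_num
  rw [← inner_sub_left, h, EuclideanSpace.inner_single_left, map_one, one_mul]

theorem eq_zero_of_forall_inner_stepVector_eq_zero {x : EucSpace d}
    (h : ∀ m, inner ℝ (stepVector d m) x = 0) : x = 0 := by
  ext j
  rw [← inner_stepVector_sub_inner_stepVector_succ, h, h, sub_zero, PiLp.zero_apply]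

theorem exists_eq_smul_of_inner_stepVector_eq_zero {n : ℕ} {x : EucSpace (n + 1)} (i : Fin n)
    (h : ∀ m ≠ (i : ℕ) + 1, inner ℝ (stepVector (n + 1) m) x = 0) :
    ∃ t : ℝ, x =
      t • (EuclideanSpace.single i.castSucc 1 - EuclideanSpace.single i.succ 1) := by
  refine ⟨-inner ℝ (stepVector (n + 1) (i + 1)) x, ?_⟩
  ext j
  rw [← inner_stepVector_sub_inner_stepVector_succ]
  rcases eq_or_ne (j : ℕ) i with hj | hj
  · rw [h j (by omega), hj]
    simp [Fin.ext_iff, hj]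
  rcases eq_or_ne (j : ℕ) (i + 1) with hj' | hj'
  · rw [h (j + 1) (by omega), hj']
    simp [Fin.ext_iff, hj']
  · rw [h j hj', h (j + 1) (by omega)]
    simp [Fin.ext_iff, hj, hj']

theorem eq_smul_stepVector_add_sum {n : ℕ} (z : EucSpace (n + 1)) :
    z = z 0 • stepVector (n + 1) 0 +
      ∑ i : Fin n, (z i.succ - z i.castSucc) • stepVector (n + 1) (i + 1) := by
  ext j
  simp only [PiLp.add_apply, PiLp.smul_apply, WithLp.ofLp_sum, Finset.sum_apply, smul_eq_mul,
    stepVector_apply, Nat.zero_le, if_true, mul_one, Nat.succ_le_iff]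
  induction j using Fin.induction with
  | zero => simp
  | succ j ih =>
    have hsplit : ∀ i : Fin n, (if (i : ℕ) < j.succ then (1 : ℝ) else 0) =
        (if (i : ℕ) < j.castSucc then 1 else 0) + if i = j then 1 else 0 := fun i => by
      simp only [Fin.val_succ, Fin.val_castSucc, Fin.ext_iff]
      split_ifs <;> first | omega | norm_num
    simp only [hsplit, mul_add, Finset.sum_add_distrib, ← add_assoc, ← ih]
    simp

end StepVector

section Permutahedron

variable {d : ℕ}

theorem permuteCoords_mem_permutahedron (σ : Equiv.Perm (Fin d)) (z : EucSpace d) :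
    permuteCoords σ z ∈ permutahedron z :=
  subset_convexHull ℝ _ ⟨σ, rfl⟩

theorem convex_permutahedron (z : EucSpace d) : Convex ℝ (permutahedron z) :=
  convex_convexHull ℝ _

theorem permutahedron_permuteCoords (τ : Equiv.Perm (Fin d)) (z : EucSpace d) :
    permutahedron (permuteCoords τ z) = permutahedron z :=
  congrArg (convexHull ℝ) <|
    (Equiv.mulLeft τ).surjective.range_comp fun σ => permuteCoords σ z

theorem image_permuteCoords_permutahedron (τ : Equiv.Perm (Fin d)) (z : EucSpace d) :
    permuteCoords τ '' permutahedron z = permutahedron z := by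
  have h := (permuteCoordsIsometry τ).toLinearEquiv.toLinearMap.image_convexHull
    (Set.range fun σ : Equiv.Perm (Fin d) => permuteCoords σ z)
  refine h.trans (congrArg (convexHull ℝ) ?_)
  rw [← Set.range_comp]
  exact (Equiv.mulRight τ).surjective.range_comp fun σ => permuteCoords σ z

theorem permutahedron_zero : permutahedron (0 : EucSpace d) = 0 := by
  have h : (fun σ : Equiv.Perm (Fin d) => permuteCoords σ (0 : EucSpace d)) = fun _ => 0 := rfl
  rw [permutahedron, h, Set.range_const, convexHull_singleton, Set.singleton_zero]

theorem permutahedron_smul (a : ℝ) (z : EucSpace d) :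
    permutahedron (a • z) = a • permutahedron z := by
  rw [permutahedron, permutahedron, ← convexHull_smul, ← Set.image_smul, ← Set.range_comp]
  rfl

theorem vadd_permutahedron (c z : EucSpace d) :
    c +ᵥ permutahedron z =
      convexHull ℝ (Set.range fun σ : Equiv.Perm (Fin d) => c + permuteCoords σ z) := by
  rw [permutahedron, ← convexHull_vadd, ← Set.image_vadd, ← Set.range_comp]
  rfl

theorem permutahedron_add_of_forall_permuteCoords_eq {c : EucSpace d}
    (hc : ∀ σ, permuteCoords σ c = c) (z : EucSpace d) :
    permutahedron (c + z) = c +ᵥ permutahedron z := by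
  rw [vadd_permutahedron, permutahedron]
  congr! 3 with σ
  rw [← coe_permuteCoordsIsometry, map_add, coe_permuteCoordsIsometry, hc]

/-- This is the rearrangement inequality. -/
theorem permuteCoords_inv_mem_maxFace_permutahedron {z c : EucSpace d} {τ : Equiv.Perm (Fin d)}
    (hz : Monotone z.ofLp) (hc : c ∈ braidCone τ) :
    permuteCoords τ⁻¹ z ∈ maxFace (permutahedron z) c := by
  refine mem_maxFace_convexHull ⟨⟨τ⁻¹, rfl⟩, ?_⟩
  rintro _ ⟨σ, rfl⟩
  simp only [PiLp.inner_apply, permuteCoords_apply, RCLike.inner_apply, conj_trivial]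
  rw [← Equiv.sum_comp τ, ← Equiv.sum_comp τ fun i => z (τ⁻¹ i) * c i]
  simp only [Equiv.Perm.inv_def, Equiv.symm_apply_apply]
  exact (hz.monovary hc).sum_comp_perm_mul_le_sum_mul (σ := σ * τ)

theorem permutahedron_add {x y : EucSpace d} (hx : Monotone x.ofLp) (hy : Monotone y.ofLp) :
    permutahedron (x + y) = permutahedron x + permutahedron y := by
  refine (eq_convexHull_of_forall_exists_mem_maxFace
    ((convex_permutahedron x).add (convex_permutahedron y)) (Set.finite_range _) ?_
    fun c => ⟨_, ⟨(Tuple.sort c.ofLp)⁻¹, rfl⟩, ?_⟩).symm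
  · rintro _ ⟨σ, rfl⟩
    exact Set.add_mem_add (permuteCoords_mem_permutahedron σ x)
      (permuteCoords_mem_permutahedron σ y)
  · exact add_mem_maxFace_add
      (permuteCoords_inv_mem_maxFace_permutahedron hx (mem_braidCone_sort c))
      (permuteCoords_inv_mem_maxFace_permutahedron hy (mem_braidCone_sort c))

theorem monotone_sum_ofLp {ι : Type*} {s : Finset ι} {u : ι → EucSpace d}
    (hu : ∀ i ∈ s, Monotone (u i).ofLp) : Monotone (∑ i ∈ s, u i).ofLp := fun j k hjk => by
  simp only [WithLp.ofLp_sum, Finset.sum_apply]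
  exact Finset.sum_le_sum fun i hi => hu i hi hjk

theorem permutahedron_sum {ι : Type*} (s : Finset ι) (u : ι → EucSpace d)
    (hu : ∀ i ∈ s, Monotone (u i).ofLp) :
    permutahedron (∑ i ∈ s, u i) = ∑ i ∈ s, permutahedron (u i) := by
  classical
  induction s using Finset.induction_on with
  | empty => simpa using permutahedron_zero
  | insert a s ha ih =>
    obtain ⟨hua, hus⟩ := (Finset.forall_mem_insert ..).1 hu
    rw [Finset.sum_insert ha, Finset.sum_insert ha, permutahedron_add hua (monotone_sum_ofLp hus),
      ih hus]

theorem zero_mem_permutahedron [NeZero d] {z : EucSpace d} (hz : ∑ i, z i = 0) :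
    0 ∈ permutahedron z := by
  have hmean : ∑ k : Fin d, (d : ℝ)⁻¹ • permuteCoords (Equiv.addRight k) z = 0 := by
    ext i
    have hi : ∑ k, z (i + k) = ∑ k, z k := Equiv.sum_comp (Equiv.addLeft i) fun k => z k
    simp [← Finset.mul_sum, hi, hz]
  rw [← hmean]
  exact (convex_permutahedron z).sum_mem (fun _ _ => by positivity) (by simp)
    fun k _ => permuteCoords_mem_permutahedron _ z

end Permutahedron

section Hypersimplex

variable {d : ℕ}

theorem exists_permuteCoords_eq_of_ncard_eq {x y : EucSpace d} (hx : ∀ i, x i = 0 ∨ x i = 1)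
    (hy : ∀ i, y i = 0 ∨ y i = 1)
    (h : {i : Fin d | x i = 1}.ncard = {i : Fin d | y i = 1}.ncard) :
    ∃ σ : Equiv.Perm (Fin d), permuteCoords σ y = x := by
  classical
  obtain ⟨e⟩ : Nonempty ({i : Fin d // x i = 1} ≃ {i : Fin d // y i = 1}) :=
    Finite.card_eq.1 h
  refine ⟨e.extendSubtype, ?_⟩
  ext i
  rw [permuteCoords_apply]
  by_cases hi : x i = 1
  · rw [hi, e.extendSubtype_mem i hi]
  · rw [(hx i).resolve_right hi, (hy _).resolve_right (e.extendSubtype_not_mem i hi)]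

theorem permutahedron_stepVector (m : ℕ) :
    permutahedron (stepVector d m) = hypersimplex d (d - m) := by
  refine congrArg (convexHull ℝ) (Set.Subset.antisymm ?_ fun x hx => ?_)
  · rintro _ ⟨σ, rfl⟩
    refine ⟨fun i => stepVector_apply_eq_zero_or_one m (σ i), ?_⟩
    rw [← ncard_stepVector_eq_one]
    exact Set.ncard_preimage_of_injective_subset_range
      (s := {i : Fin d | stepVector d m i = 1}) σ.injective (by simp)
  · exact exists_permuteCoords_eq_of_ncard_eq hx.1 (stepVector_apply_eq_zero_or_one m)
      (hx.2.trans (ncard_stepVector_eq_one m).symm)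

theorem permutahedron_eq_sum_hypersimplex {n : ℕ} {z : EucSpace (n + 1)} (hz : Monotone z.ofLp) :
    permutahedron z = z 0 • hypersimplex (n + 1) (n + 1) +
      ∑ i : Fin n, (z i.succ - z i.castSucc) • hypersimplex (n + 1) (n - (i : ℕ)) := by
  have hconst : Monotone (z 0 • stepVector (n + 1) 0).ofLp := fun j k _ => by
    simp [stepVector_apply]
  have hstep : ∀ i ∈ Finset.univ,
      Monotone ((z (Fin.succ i) - z i.castSucc) • stepVector (n + 1) (i + 1)).ofLp :=
    fun i _ => (monotone_stepVector _).const_mul (sub_nonneg.2 (hz i.castSucc_le_succ))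
  conv_lhs => rw [eq_smul_stepVector_add_sum z]
  simp only [permutahedron_add hconst (monotone_sum_ofLp hstep), permutahedron_sum _ _ hstep,
    permutahedron_smul, permutahedron_stepVector, Nat.sub_zero, Nat.add_sub_add_right]

end Hypersimplex

/-- The family `v` lists the vertices of a polytope `P` with the normal fan of the braid
arrangement: `v τ` is the vertex with the normal cone `braidCone τ`. -/
def IsBraidVertexFamily {d : ℕ} (P : Set (EucSpace d))
    (v : Equiv.Perm (Fin d) → EucSpace d) : Prop :=
  ∀ τ, v τ ∈ Set.extremePoints ℝ P ∧ ∀ c, v τ ∈ maxFace P c ↔ c ∈ braidCone τ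

theorem subsingleton_of_normalConeAt_eq_braidCone {d : ℕ} {P F : Set (EucSpace d)}
    {τ : Equiv.Perm (Fin d)} (h : normalConeAt P F = braidCone τ) : F.Subsingleton := by
  intro x hx y hy
  refine sub_eq_zero.1 (permuteCoords_injective τ ?_)
  refine eq_zero_of_forall_inner_stepVector_eq_zero fun m => ?_
  have hmem : permuteCoords τ⁻¹ (stepVector d m) ∈ normalConeAt P F :=
    h ▸ permuteCoords_inv_mem_braidCone τ (monotone_stepVector m)
  rw [← inner_permuteCoords_inv, inner_sub_right, sub_eq_zero]
  exact inner_eq_of_mem_maxFace (hmem hx) (hmem hy)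

theorem exists_isBraidVertexFamily {d : ℕ} {P : Set (EucSpace d)}
    (hP : normalFan P = braidFan d) : ∃ v, IsBraidVertexFamily P v := by
  refine Classical.axiomOfChoice (r := fun τ v =>
    v ∈ Set.extremePoints ℝ P ∧ ∀ c, v ∈ maxFace P c ↔ c ∈ braidCone τ) fun τ => ?_
  obtain ⟨F, ⟨hne, c₀, hF⟩, hcone⟩ : braidCone τ ∈ normalFan P := hP ▸ braidCone_mem_braidFan τ
  obtain ⟨v, rfl⟩ := (Set.exists_eq_singleton_iff_nonempty_subsingleton).2
    ⟨hne, subsingleton_of_normalConeAt_eq_braidCone hcone.symm⟩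
  refine ⟨v, mem_extremePoints_of_maxFace_eq_singleton hF.symm, fun c => ?_⟩
  rw [hcone]
  simp [normalConeAt]

namespace IsBraidVertexFamily

variable {n d : ℕ}

theorem injective {P : Set (EucSpace d)} {v : Equiv.Perm (Fin d) → EucSpace d}
    (hv : IsBraidVertexFamily P v) : Function.Injective v := fun σ τ h =>
  braidCone_injective <| Set.ext fun c => by rw [← (hv σ).2, ← (hv τ).2, h]

theorem eq_convexHull_range {P : Set (EucSpace d)} {v : Equiv.Perm (Fin d) → EucSpace d}
    (hv : IsBraidVertexFamily P v) (hP : Convex ℝ P) : P = convexHull ℝ (Set.range v) :=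
  eq_convexHull_of_forall_exists_mem_maxFace hP (Set.finite_range v)
    (Set.range_subset_iff.2 fun τ => (hv τ).1.1)
    fun c => ⟨_, ⟨Tuple.sort c.ofLp, rfl⟩, ((hv _).2 c).2 (mem_braidCone_sort c)⟩

variable {P : Set (EucSpace (n + 1))} {v : Equiv.Perm (Fin (n + 1)) → EucSpace (n + 1)}

theorem exists_permuteCoords_sub_eq_smul (hv : IsBraidVertexFamily P v)
    (τ : Equiv.Perm (Fin (n + 1))) (i : Fin n) :
    ∃ t : ℝ, permuteCoords τ (v τ - v (τ * Equiv.swap i.castSucc i.succ)) =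
      t • (EuclideanSpace.single i.castSucc 1 - EuclideanSpace.single i.succ 1) := by
  refine exists_eq_smul_of_inner_stepVector_eq_zero i fun m hm => ?_
  set g := permuteCoords τ⁻¹ (stepVector (n + 1) m) with hg
  have hτ : g ∈ braidCone τ := permuteCoords_inv_mem_braidCone τ (monotone_stepVector m)
  have hwall : g (τ i.castSucc) = g (τ i.succ) := by
    simp only [hg, permuteCoords_apply, Equiv.Perm.inv_def, Equiv.symm_apply_apply,
      stepVector_apply,
      Fin.val_castSucc, Fin.val_succ]
    split_ifs <;> first | omega | rfl
  rw [← inner_permuteCoords_inv, ← hg, inner_sub_right, sub_eq_zero]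
  exact inner_eq_of_mem_maxFace (((hv _).2 g).2 hτ)
    (((hv _).2 g).2 (mem_braidCone_mul_swap hτ hwall))

theorem permuteCoords_mul_swap_sub (hv : IsBraidVertexFamily P v) {c : EucSpace (n + 1)} {r : ℝ}
    (hc : Set.extremePoints ℝ P ⊆ Metric.sphere c r) (τ : Equiv.Perm (Fin (n + 1)))
    (i : Fin n) :
    permuteCoords (τ * Equiv.swap i.castSucc i.succ)
      (v (τ * Equiv.swap i.castSucc i.succ) - c) = permuteCoords τ (v τ - c) := by
  set s := Equiv.swap i.castSucc i.succ with hs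
  obtain ⟨t, ht⟩ := hv.exists_permuteCoords_sub_eq_smul τ i
  have hdiff : permuteCoords τ (v τ - c) - permuteCoords τ (v (τ * s) - c) =
      t • (EuclideanSpace.single i.castSucc 1 - EuclideanSpace.single i.succ 1) := by
    rw [← ht, ← coe_permuteCoordsIsometry, ← map_sub, sub_sub_sub_cancel_right]
  have hnorm : ‖permuteCoords τ (v τ - c)‖ = ‖permuteCoords τ (v (τ * s) - c)‖ := by
    rw [norm_permuteCoords, norm_permuteCoords, mem_sphere_iff_norm.1 (hc (hv τ).1),
      mem_sphere_iff_norm.1 (hc (hv (τ * s)).1)]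
  have hne : permuteCoords τ (v τ - c) ≠ permuteCoords τ (v (τ * s) - c) := fun h => by
    have hτ : τ = τ * s := hv.injective (sub_left_injective (permuteCoords_injective τ h))
    exact i.castSucc_lt_succ.ne (Equiv.swap_eq_one_iff.1 (left_eq_mul.1 hτ))
  rw [← permuteCoords_permuteCoords, ← permuteCoords_swap_of_sub_eq_smul hdiff hnorm hne, ← hs,
    permuteCoords_permuteCoords, Equiv.swap_mul_self, permuteCoords_one]

theorem permuteCoords_sub (hv : IsBraidVertexFamily P v) {c : EucSpace (n + 1)} {r : ℝ}
    (hc : Set.extremePoints ℝ P ⊆ Metric.sphere c r) (τ : Equiv.Perm (Fin (n + 1))) :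
    permuteCoords τ (v τ - c) = v 1 - c := by
  induction τ using Submonoid.induction_of_closure_eq_top_right
    (Equiv.Perm.mclosure_swap_castSucc_succ n) with
  | one => rfl
  | mul_right τ s hs ih =>
    obtain ⟨i, rfl⟩ := hs
    rw [hv.permuteCoords_mul_swap_sub hc, ih]

theorem eq_vadd_permutahedron (hv : IsBraidVertexFamily P v) (hP : Convex ℝ P)
    {c : EucSpace (n + 1)} {r : ℝ} (hc : Set.extremePoints ℝ P ⊆ Metric.sphere c r) :
    P = c +ᵥ permutahedron (v 1 - c) := by
  have hvertex : ∀ τ, c + permuteCoords τ⁻¹ (v 1 - c) = v τ := fun τ => by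
    rw [← hv.permuteCoords_sub hc τ, permuteCoords_permuteCoords, mul_inv_cancel,
      permuteCoords_one, add_sub_cancel]
  rw [vadd_permutahedron, hv.eq_convexHull_range hP,
    ← inv_surjective.range_comp fun τ => c + permuteCoords τ (v 1 - c)]
  simp only [Function.comp_def, hvertex]

end IsBraidVertexFamily

theorem exists_sum_eq_zero_and_vadd_permutahedron_eq {d : ℕ} (c z : EucSpace d) :
    ∃ c' z' : EucSpace d, ∑ i, z' i = 0 ∧ c' +ᵥ permutahedron z' = c +ᵥ permutahedron z := by
  set m : EucSpace d := WithLp.toLp 2 fun _ => (∑ i, z i) / d with hm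
  refine ⟨c + m, z - m, ?_, ?_⟩
  · rcases eq_or_ne d 0 with rfl | hd
    · simp
    · have hd' : (d : ℝ) ≠ 0 := Nat.cast_ne_zero.2 hd
      simp [hm, Finset.sum_sub_distrib, mul_div_cancel₀, hd']
  · rw [add_vadd, ← permutahedron_add_of_forall_permuteCoords_eq (c := m) fun _ => rfl,
      add_sub_cancel]

section Closure

variable {d : ℕ}

theorem isClosed_image_of_dist_le {X Y : Type*} [PseudoMetricSpace X] [ProperSpace X]
    [MetricSpace Y] {f : X → Y} (hf : Continuous f) {S : Set X} (hS : IsClosed S) {x₀ : X} {y₀ : Y}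
    {C : ℝ} (h : ∀ x ∈ S, dist x x₀ ≤ C * dist (f x) y₀) : IsClosed (f '' S) := by
  refine isClosed_of_closure_subset fun y hy => ?_
  set K := S ∩ Metric.closedBall x₀ (|C| * (dist y y₀ + 1))
  have hK : IsClosed (f '' K) :=
    (((isCompact_closedBall _ _).inter_left hS).image hf).isClosed
  suffices y ∈ closure (f '' K) from Set.image_mono Set.inter_subset_left (hK.closure_subset this)
  refine mem_closure_iff_nhds.2 fun U hU => ?_
  obtain ⟨_, ⟨hxU, hxy⟩, x, hx, rfl⟩ :=
    mem_closure_iff_nhds.1 hy _ (Filter.inter_mem hU (Metric.ball_mem_nhds y one_pos))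
  refine ⟨f x, hxU, x, ⟨hx, (h x hx).trans ?_⟩, rfl⟩
  have hfx : dist (f x) y₀ ≤ dist y y₀ + 1 := by
    linarith [dist_triangle (f x) y y₀, Metric.mem_ball.1 hxy]
  exact mul_le_mul (le_abs_self C) hfx dist_nonneg (abs_nonneg C)

/-- The translate `c + P(z)` of a permutahedron as a function of the pair `(c, z)`, with values in
the space of non-empty compact sets. -/
noncomputable def translatedPermutahedron (p : EucSpace d × EucSpace d) :
    NonemptyCompacts (EucSpace d) :=
  convexHullRange fun σ : Equiv.Perm (Fin d) => p.1 + permuteCoords σ p.2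

theorem coe_translatedPermutahedron (p : EucSpace d × EucSpace d) :
    (translatedPermutahedron p : Set (EucSpace d)) = p.1 +ᵥ permutahedron p.2 :=
  (vadd_permutahedron p.1 p.2).symm

theorem continuous_translatedPermutahedron :
    Continuous (translatedPermutahedron : EucSpace d × EucSpace d → _) :=
  (lipschitzWith_convexHullRange (ι := Equiv.Perm (Fin d))).continuous.comp <|
    continuous_pi fun σ =>
      continuous_fst.add ((permuteCoordsIsometry σ).continuous.comp continuous_snd)

/-- The pairs `(c, z)` for which the entries of `z` sum to `0`, so that `c` lies in `c + P(z)`. -/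
def centeredPairs (d : ℕ) : Set (EucSpace d × EucSpace d) :=
  {p | ∑ i, p.2 i = 0}

theorem norm_le_dist_singleton_zero {E : Type*} [NormedAddCommGroup E] {K : NonemptyCompacts E}
    {x : E} (hx : x ∈ K) : ‖x‖ ≤ dist K {0} := by
  have hfin := Metric.hausdorffEDist_ne_top_of_nonempty_of_bounded K.nonempty
    (Set.singleton_nonempty (0 : E)) K.isCompact.isBounded Bornology.isBounded_singleton
  calc ‖x‖ = Metric.infDist x {0} := by rw [Metric.infDist_singleton, dist_zero_right]
    _ ≤ dist K {0} := Metric.infDist_le_hausdorffDist_of_mem hx hfin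

theorem dist_zero_le_of_mem_centeredPairs [NeZero d] {p : EucSpace d × EucSpace d}
    (hp : p ∈ centeredPairs d) : dist p 0 ≤ 2 * dist (translatedPermutahedron p) {0} := by
  have hmem : ∀ x ∈ permutahedron p.2, p.1 + x ∈ translatedPermutahedron p := fun x hx => by
    rw [← SetLike.mem_coe, coe_translatedPermutahedron]
    exact Set.vadd_mem_vadd_set hx
  have hc := norm_le_dist_singleton_zero (hmem 0 (zero_mem_permutahedron hp))
  have hcz := norm_le_dist_singleton_zero (hmem p.2 (permuteCoords_mem_permutahedron 1 p.2))
  rw [add_zero] at hc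
  have hz : ‖p.2‖ ≤ ‖p.1 + p.2‖ + ‖p.1‖ := norm_le_add_norm_add' _ _
  rw [dist_zero_right, Prod.norm_def]
  exact max_le (by linarith [norm_nonneg p.1]) (by linarith)

theorem isClosed_image_translatedPermutahedron [NeZero d] :
    IsClosed (translatedPermutahedron '' centeredPairs d) :=
  isClosed_image_of_dist_le continuous_translatedPermutahedron
    (isClosed_eq (by fun_prop) continuous_const) fun _ => dist_zero_le_of_mem_centeredPairs

theorem inscribedCone_braidFan_subset (n : ℕ) :
    inscribedCone (braidFan (n + 1)) ⊆ translatedPermutahedron '' centeredPairs (n + 1) := by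
  rintro P ⟨⟨s, -, hs⟩, ⟨c, r, -, hc⟩, hfan⟩
  obtain ⟨v, hv⟩ := exists_isBraidVertexFamily hfan
  have hP := hv.eq_vadd_permutahedron (hs ▸ convex_convexHull ℝ _) hc
  obtain ⟨c', z', hsum, heq⟩ := exists_sum_eq_zero_and_vadd_permutahedron_eq c (v 1 - c)
  exact ⟨(c', z'), hsum, NonemptyCompacts.ext <| by
    rw [coe_translatedPermutahedron, heq, ← hP]⟩

theorem isInscribedCenter_vadd_permutahedron [NeZero d] (c : EucSpace d) {z : EucSpace d}
    (hz : ∑ i, z i = 0) : IsInscribedCenter (c +ᵥ permutahedron z) c := by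
  refine ⟨subset_affineSpan ℝ _ ?_, ‖z‖, ?_⟩
  · simpa using Set.vadd_mem_vadd_set (a := c) (zero_mem_permutahedron hz)
  · rw [vadd_permutahedron]
    refine extremePoints_convexHull_subset.trans ?_
    rintro _ ⟨σ, rfl⟩
    simp [norm_permuteCoords]

end Closure

/-- Here `d = n + 1`, the coordinates `z_1, …, z_d` are `z 0, …, z (Fin.last n)`, and the sum
below is `z_1 Δ(d, d) + ∑_{i = 2}^{d} (z_i - z_{i-1}) Δ(d, d - i + 1)`, a Minkowski sum. -/
theorem mainTheorem9 (n : ℕ) (P : NonemptyCompacts (EucSpace (n + 1)))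
    (hP : P ∈ closedInscribedCone (braidFan (n + 1))) :
    ∃ c : EucSpace (n + 1), IsInscribedCenter (P : Set (EucSpace (n + 1))) c ∧
      (∃ z : EucSpace (n + 1), (∀ i j : Fin (n + 1), i ≤ j → z i ≤ z j) ∧
        (-c) +ᵥ (P : Set (EucSpace (n + 1))) = permutahedron z ∧
        permutahedron z = z 0 • hypersimplex (n + 1) (n + 1) +
          ∑ i : Fin n, (z i.succ - z i.castSucc) • hypersimplex (n + 1) (n - (i : ℕ))) ∧
      ∀ σ : Equiv.Perm (Fin (n + 1)),
        permuteCoords σ '' ((-c) +ᵥ (P : Set (EucSpace (n + 1)))) =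
          (-c) +ᵥ (P : Set (EucSpace (n + 1))) := by
  obtain ⟨⟨c, z⟩, hsum, rfl⟩ :=
    closure_minimal (inscribedCone_braidFan_subset n) isClosed_image_translatedPermutahedron hP
  set ρ := Tuple.sort z.ofLp
  have hmono : Monotone (permuteCoords ρ z).ofLp := Tuple.monotone_sort z.ofLp
  have hP' : -c +ᵥ (translatedPermutahedron (c, z) : Set (EucSpace (n + 1))) = permutahedron z := by
    rw [coe_translatedPermutahedron, neg_vadd_vadd]
  refine ⟨c, ?_, ⟨permuteCoords ρ z, fun _ _ hij => hmono hij,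
    hP'.trans (permutahedron_permuteCoords ρ z).symm, permutahedron_eq_sum_hypersimplex hmono⟩,
    fun σ => by rw [hP', image_permuteCoords_permutahedron]⟩
  rw [coe_translatedPermutahedron]
  exact isInscribedCenter_vadd_permutahedron c hsum
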